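/- Let $r,p\ge 1$ and $m\ge p+r$ be integers, let $a_{-r},\dots,a_p\in\mathbb{C}$ with $a_{-r}\neq 0$ and $a_p\neq 0$, and let $B=(b_{j,k})_{-r\le j\le -1,\,0\le k\le m-1}$ be a complex $r\times m$ matrix. Consider the scheme $U_j^{n+1}=\sum_{k=-r}^{p}a_kU_{j+k}^n$ ($j\ge 0$) with the boundary condition $U_j^n=\sum_{k=0}^{m-1}b_{j,k}U_k^n+g_j^n$ ($-r\le j\le -1$), where $(g_j^n)$ are given boundary data. Eliminating the ghost values $U_{-r}^n,\dots,U_{-1}^n$ when $g=0$ gives $(U_0^{n+1},\dots,U_{r-1}^{n+1})^T=\mathcal{B}\,(U_0^n,\dots,U_{m-1}^n)^T$, where $\mathcal{B}=TB+A\in\mathcal{M}_{r,m}(\mathbb{C})$ has, for indices starting at $0$, $T_{i,l}=a_{-r+l-i}$ if $i\le l\le r-1$ and $T_{i,l}=0$ if $l<i$, and $A_{i,k}=a_{k-i}$ if $k\le i+p$ and $A_{i,k}=0$ otherwise. Assume that the scheme is Cauchy-stable: $\left|\sum_{k=-r}^{p}a_ke^{ik\xi}\right|\le 1$ for all $\xi\in\mathbb{R}$.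 For $|z|>1$, let the stable roots at $z$ be the roots $\kappa$, counted with multiplicity, of the characteristic equation $z\kappa^r=\sum_{k=-r}^{p}a_k\kappa^{r+k}$ with $|\kappa|<1$. For $|z|=1$, let the stable roots at $z$ be the limit, as a multiset, of the stable roots at $w$ as $w\to z$ with $|w|>1$ (the roots that come from inside the disk). For $|z|\ge 1$ let $\kappa_1,\dots,\kappa_M$ be the distinct stable roots at $z$, with multiplicities $\mu_1,\dots,\mu_M$ in this multiset, and for $n\ge 1$ let $K_{0,n-1}(z)$ be the matrix with rows $j=0,\dots,n-1$ whose columns are $(j^{\sigma}\kappa_\ell^{\,j})_{0\le j\le n-1}$ for $1\le\ell\le M$ and $0\le\sigma<\mu_\ell$ (with $0^0=1$), in any order, the same for all $n$. The intrinsic Kreiss-Lopatinskii determinant is $$\Delta(z)=\frac{\det\left(zK_{0,r-1}(z)-\mathcal{B}K_{0,m-1}(z)\right)}{\det K_{0,r-1}(z)},\qquad |z|\ge 1.$$ Then $\Delta$ is well defined on $\{|z|\ge 1\}$: for $|z|=1$ the limit multiset exists and is unique, for $|z|\ge 1$ there are exactly $r$ stable roots counted with multiplicity, $\det K_{0,r-1}(z)\ne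 0$, and the quotient does not depend on the order of the columns. Moreover, $\Delta$ is holomorphic on $\{z\in\mathbb{C}:|z|>1\}$ and continuous on $\{z\in\mathbb{C}:|z|\ge 1\}$. -/

import Mathlib

open Polynomial Filter Topology

namespace KreissLopatinskii

noncomputable section

/-- The symbol `γ(ξ) = ∑_{k=-r}^{p} a_k e^{ikξ}` of the scheme
`U_j^{n+1} = ∑_{k=-r}^{p} a_k U_{j+k}^n`. Only the values `a k` with `-r ≤ k ≤ p` matter. -/
def symbol (r p : ℕ) (a : ℤ → ℂ) (ξ : ℝ) : ℂ :=
  ∑ k ∈ Finset.Icc (-(r : ℤ)) (p : ℤ), a k * Complex.exp (Complex.I * (k : ℂ) * (ξ : ℂ))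

/-- Cauchy-stability: `|γ(ξ)| ≤ 1` for all real `ξ`. -/
def CauchyStable (r p : ℕ) (a : ℤ → ℂ) : Prop :=
  ∀ ξ : ℝ, ‖symbol r p a ξ‖ ≤ 1

/-- The polynomial `P_z(κ) = ∑_{k=-r}^{p} a_k κ^{r+k} - z κ^r` of the characteristic equation;
the summation index is `l = r + k`. -/
def charPoly (r p : ℕ) (a : ℤ → ℂ) (z : ℂ) : ℂ[X] :=
  (∑ l ∈ Finset.range (r + p + 1), C (a ((l : ℤ) - (r : ℤ))) * X ^ l) - C z * X ^ r

open Classical in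
/-- The roots of the characteristic equation in the open unit disk, with multiplicity. -/
def insideRoots (r p : ℕ) (a : ℤ → ℂ) (z : ℂ) : Multiset ℂ :=
  (charPoly r p a z).roots.filter (fun κ => ‖κ‖ < 1)

/-- `s` is the limit, as a multiset, of the roots lying in the open unit disk for the parameter
`w` when `w → z` with `|w| > 1`: for every `ε > 0` and every such `w` close enough to `z`, the
roots for `w` can be matched one-to-one with the elements of `s` at distance less than `ε`.
For `|z| = 1` these are the roots for `z` that come from inside the disk. -/
def ComesFromInside (r p : ℕ) (a : ℤ → ℂ) (z : ℂ) (s : Multiset ℂ) : Prop :=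
  ∀ ε : ℝ, 0 < ε → ∀ᶠ w in 𝓝[{w : ℂ | 1 < ‖w‖}] z,
    Multiset.Rel (fun κ κ' : ℂ => ‖κ - κ'‖ < ε) (insideRoots r p a w) s

open Classical in
/-- The stable roots, with multiplicity: for `|z| > 1` the roots in the open unit disk, and for
`|z| = 1` the roots that come from inside the disk. -/
def stableRoots (r p : ℕ) (a : ℤ → ℂ) (z : ℂ) : Multiset ℂ :=
  if 1 < ‖z‖ then insideRoots r p a z
  else if h : ∃ s, ComesFromInside r p a z s then h.choose else 0

/-- The matrix `K_{0,n-1}` attached to a multiset of roots. Its columns are indexed by the pairs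
`(κ, σ)` with `0 ≤ σ < multiplicity of κ`, and the column `(κ, σ)` is `(j^σ κ^j)_{0 ≤ j ≤ n-1}`
(with `0^0 = 1`). -/
def kMatrix (n : ℕ) (s : Multiset ℂ) : Matrix (Fin n) s.ToType ℂ :=
  Matrix.of fun j c => ((j : ℕ) : ℂ) ^ (c.2 : ℕ) * c.1 ^ (j : ℕ)

/-- `K_{0,n-1}(z)` with its `r` columns listed in the order `e`. -/
def kMat (r p : ℕ) (a : ℤ → ℂ) (z : ℂ) (e : Fin r ≃ (stableRoots r p a z).ToType) (n : ℕ) :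
    Matrix (Fin n) (Fin r) ℂ :=
  (kMatrix n (stableRoots r p a z)).submatrix id e

/-- The matrix `𝓑` obtained by eliminating the ghost values
`U_j = ∑_{k=0}^{m-1} b_{j,k} U_k`, `-r ≤ j ≤ -1`, from the scheme at the points `0, …, r-1`.
The row `l` of `b` holds the coefficients `b_{-r+l,k}`. -/
def boundaryMatrix (r p m : ℕ) (a : ℤ → ℂ) (b : Matrix (Fin r) (Fin m) ℂ) :
    Matrix (Fin r) (Fin m) ℂ :=
  (Matrix.of fun i l : Fin r =>
      if (i : ℕ) ≤ (l : ℕ) then a (-(r : ℤ) + ((l : ℕ) : ℤ) - ((i : ℕ) : ℤ)) else 0) * b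
    + Matrix.of fun (i : Fin r) (k : Fin m) =>
      if (k : ℕ) ≤ (i : ℕ) + p then a (((k : ℕ) : ℤ) - ((i : ℕ) : ℤ)) else 0

/-- The Kreiss-Lopatinskii determinant `det (z K_{0,r-1}(z) - 𝓑 K_{0,m-1}(z))`, for the order `e`
of the columns. -/
def klDet (r p m : ℕ) (a : ℤ → ℂ) (b : Matrix (Fin r) (Fin m) ℂ) (z : ℂ)
    (e : Fin r ≃ (stableRoots r p a z).ToType) : ℂ :=
  (z • kMat r p a z e r - boundaryMatrix r p m a b * kMat r p a z e m).det

open Classical in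
/-- The intrinsic Kreiss-Lopatinskii determinant
`Δ(z) = det (z K_{0,r-1}(z) - 𝓑 K_{0,m-1}(z)) / det K_{0,r-1}(z)`, computed with any order of the
columns. -/
def intrinsicDet (r p m : ℕ) (a : ℤ → ℂ) (b : Matrix (Fin r) (Fin m) ℂ) (z : ℂ) : ℂ :=
  if h : Nonempty (Fin r ≃ (stableRoots r p a z).ToType) then
    klDet r p m a b z h.some / (kMat r p a z h.some r).det
  else 0

end

end KreissLopatinskii

/-! Let `Q` be the monic polynomial whose roots are the stable roots at `z`. The functionals `P ↦
((X d/dX)^σ P)(κ)` send `X ^ j` to `j^σ κ^j`, and for nonzero roots they vanish together exactly on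
the multiples of `Q`. Hence `K_{0,r-1}` is invertible and `K_{0,n-1} = R_n K_{0,r-1}`, where `R_n`
lists the remainders of `X ^ j` modulo `Q`. Cancelling `det K_{0,r-1}` gives `Δ(z) = det (z - 𝓑
R_m)`, which is free of the column order and polynomial in `z` and the coefficients of `Q`, even
where roots collide (`klDet_div_eq`). It remains to study those coefficients.

With `u = 1/z` the characteristic polynomial is `z (u A - X ^ r)`, where `|A| ≤ 1` on the unit
circle by Cauchy stability. For `|u| < 1` no root meets the circle, so the power sums of the inner
roots are integrals holomorphic in `u`. Their number is constant, equal to `r` at `u = 0`, and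
Newton's identities make the coefficients of `Q` holomorphic.

At a boundary point `u₀`, compactness gives cluster values of `Q`. Each divides the nonzero
polynomial `u₀ A - X ^ r`, so there are finitely many; connectedness of small pieces of the disk
then leaves only one (`exists_tendsto_of_finite_limits`). So `Q` has a limit at every boundary
point, and the extension by limits is continuous. -/

namespace KreissLopatinskii

noncomputable section

/-! ### Divisibility through the Euler operator -/

/-- The Euler operator `P ↦ X P'` on polynomials; it multiplies the coefficient of `X ^ j`
by `j`. -/
def euler (P : ℂ[X]) : ℂ[X] := X * derivative P

lemma euler_coeff (P : ℂ[X]) (j : ℕ) : (euler P).coeff j = j * P.coeff j := by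
  cases j with
  | zero => simp [euler]
  | succ n => simp [euler, coeff_X_mul, coeff_derivative, mul_comm]

lemma euler_iterate_coeff (σ : ℕ) (P : ℂ[X]) (j : ℕ) :
    (euler^[σ] P).coeff j = (j : ℂ) ^ σ * P.coeff j := by
  induction σ generalizing P with
  | zero => simp
  | succ n ih => rw [Function.iterate_succ_apply, ih, euler_coeff, pow_succ, mul_assoc]

lemma euler_iterate_degree_lt {σ n : ℕ} {P : ℂ[X]} (h : P.degree < n) :
    (euler^[σ] P).degree < n := by
  rw [degree_lt_iff_coeff_zero] at h ⊢
  intro m hm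
  rw [euler_iterate_coeff, h m hm, mul_zero]

lemma eval_euler_iterate {n : ℕ} {P : ℂ[X]} (h : P.degree < n) (σ : ℕ) (κ : ℂ) :
    (euler^[σ] P).eval κ = ∑ i : Fin n, P.coeff i * (((i : ℕ) : ℂ) ^ σ * κ ^ (i : ℕ)) := by
  have h' := euler_iterate_degree_lt (σ := σ) h
  rcases Nat.eq_zero_or_pos n with rfl | hn
  · rw [Nat.cast_zero, Nat.WithBot.lt_zero_iff, degree_eq_bot] at h'
    simp [h']
  · have hlt : (euler^[σ] P).natDegree < n := by
      by_cases h0 : euler^[σ] P = 0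
      · simpa [h0] using hn
      · exact (natDegree_lt_iff_degree_lt h0).2 h'
    rw [eval_eq_sum_range' hlt, Finset.sum_range]
    refine Finset.sum_congr rfl fun i _ => ?_
    rw [euler_iterate_coeff]; ring

lemma eval_euler_iterate_X_pow (j σ : ℕ) (κ : ℂ) :
    (euler^[σ] (X ^ j)).eval κ = (j : ℂ) ^ σ * κ ^ j := by
  have : euler^[σ] (X ^ j) = C ((j : ℂ) ^ σ) * X ^ j := by
    ext i
    rw [euler_iterate_coeff, coeff_C_mul, coeff_X_pow]
    split_ifs with h <;> simp [h]
  simp [this]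

lemma euler_iterate_sub (σ : ℕ) (P R : ℂ[X]) :
    euler^[σ] (P - R) = euler^[σ] P - euler^[σ] R := by
  ext j
  simp [euler_iterate_coeff, mul_sub]

/-- As `κ ≠ 0`, the factor `X` is coprime to `X - κ`, so the Euler operator can be replaced by the
derivative, which in characteristic zero lowers the multiplicity of a root by exactly one. -/
lemma X_sub_C_pow_succ_dvd_iff {κ : ℂ} (hκ : κ ≠ 0) (n : ℕ) (P : ℂ[X]) :
    (X - C κ) ^ (n + 1) ∣ P ↔ P.eval κ = 0 ∧ (X - C κ) ^ n ∣ euler P := by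
  by_cases hP : P = 0
  · simp [hP, euler]
  by_cases hr : P.IsRoot κ
  · have hcop : IsCoprime ((X - C κ) ^ n) (X : ℂ[X]) := by
      refine IsCoprime.pow_left ?_
      have := isCoprime_X_sub_C_of_isUnit_sub (a := κ) (b := 0) (by simpa using hκ)
      simpa using this
    have hX : (X - C κ) ^ n ∣ euler P ↔ (X - C κ) ^ n ∣ derivative P :=
      ⟨hcop.dvd_of_dvd_mul_left, fun h => h.mul_left _⟩
    rw [hX]
    have hd : derivative P ≠ 0 := by
      intro h
      have h1 := derivative_eq_zero.1 h
      rw [eq_C_of_natDegree_eq_zero h1] at hr hP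
      simp at hr
      simp [hr] at hP
    rw [← le_rootMultiplicity_iff hP, ← le_rootMultiplicity_iff hd,
      derivative_rootMultiplicity_of_root hr]
    have := (rootMultiplicity_pos hP).2 hr
    have h0 : P.eval κ = 0 := hr
    simp only [h0, true_and]
    omega
  · have h0 : P.eval κ ≠ 0 := hr
    simp only [h0, false_and, iff_false]
    intro h
    exact hr (dvd_iff_isRoot.1 ((dvd_pow_self _ (Nat.succ_ne_zero n)).trans h))

lemma X_sub_C_pow_dvd_iff {κ : ℂ} (hκ : κ ≠ 0) (n : ℕ) (P : ℂ[X]) :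
    (X - C κ) ^ n ∣ P ↔ ∀ σ < n, (euler^[σ] P).eval κ = 0 := by
  induction n generalizing P with
  | zero => simp
  | succ n ih =>
    rw [X_sub_C_pow_succ_dvd_iff hκ, ih, Nat.forall_lt_succ_left]
    simp

/-! ### Confluent Vandermonde matrices and reduction modulo the root polynomial -/

/-- The monic polynomial whose multiset of roots is `s`. -/
def rootPoly (s : Multiset ℂ) : ℂ[X] := (s.map fun κ => X - C κ).prod

lemma rootPoly_monic (s : Multiset ℂ) : (rootPoly s).Monic :=
  monic_multiset_prod_of_monic _ _ fun κ _ => monic_X_sub_C κ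

lemma rootPoly_natDegree (s : Multiset ℂ) : (rootPoly s).natDegree = s.card :=
  natDegree_multiset_prod_X_sub_C_eq_card s

lemma rootPoly_roots (s : Multiset ℂ) : (rootPoly s).roots = s :=
  roots_multiset_prod_X_sub_C s

lemma rootPoly_dvd_iff {s : Multiset ℂ} (hs : (0 : ℂ) ∉ s) (P : ℂ[X]) :
    rootPoly s ∣ P ↔ ∀ c : s.ToType, (euler^[(c.2 : ℕ)] P).eval c.1 = 0 := by
  have key : rootPoly s ∣ P ↔ ∀ κ, (X - C κ) ^ s.count κ ∣ P := by
    by_cases hP : P = 0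
    · simp [hP]
    · rw [rootPoly, Multiset.prod_X_sub_C_dvd_iff_le_roots hP, Multiset.le_iff_count]
      simp only [count_roots, le_rootMultiplicity_iff hP]
  rw [key]
  constructor
  · intro h c
    have hc : c.1 ∈ s := Multiset.count_pos.1 (Nat.zero_lt_of_lt c.2.2)
    exact (X_sub_C_pow_dvd_iff (fun h0 => hs (h0 ▸ hc)) _ _).1 (h c.1) _ c.2.2
  · intro h κ
    by_cases hκ : κ ∈ s
    · exact (X_sub_C_pow_dvd_iff (fun h0 => hs (h0 ▸ hκ)) _ _).2 fun σ hσ => h ⟨κ, ⟨σ, hσ⟩⟩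
    · simp [Multiset.count_eq_zero_of_notMem hκ]

lemma card_eq_of_equiv {r : ℕ} {s : Multiset ℂ} (e : Fin r ≃ s.ToType) : s.card = r := by
  rw [← Multiset.card_coe s, ← Fintype.card_congr e, Fintype.card_fin]

/-- A vector in the left kernel is the coefficient list of a polynomial of degree less than `r`
killed by all the functionals, hence divisible by a monic polynomial of degree `r`. -/
lemma kMatrix_det_ne_zero {r : ℕ} {s : Multiset ℂ} (hs : (0 : ℂ) ∉ s) (e : Fin r ≃ s.ToType) :
    ((kMatrix r s).submatrix id e).det ≠ 0 := by
  intro hdet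
  obtain ⟨v, hv, hv0⟩ := Matrix.exists_vecMul_eq_zero_iff.2 hdet
  have hco : ∀ i : Fin r, (∑ j : Fin r, C (v j) * X ^ (j : ℕ)).coeff i = v i := by
    intro i
    simp [coeff_X_pow, Fin.val_inj]
  set P : ℂ[X] := ∑ j : Fin r, C (v j) * X ^ (j : ℕ) with hP
  have hdeg : P.degree < r := by
    rw [degree_lt_iff_coeff_zero]
    intro n hn
    simp only [hP, finsetSum_coeff, coeff_C_mul, coeff_X_pow]
    refine Finset.sum_eq_zero fun j _ => ?_
    rw [if_neg (by have := j.2; omega), mul_zero]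
  have hdvd : rootPoly s ∣ P := by
    rw [rootPoly_dvd_iff hs]
    intro c
    rw [eval_euler_iterate hdeg]
    have h1 := congrFun hv0 (e.symm c)
    simpa [Matrix.vecMul, dotProduct, kMatrix, hco] using h1
  have hP0 : P = 0 := by
    refine eq_zero_of_dvd_of_degree_lt hdvd ?_
    rw [degree_eq_natDegree (rootPoly_monic s).ne_zero, rootPoly_natDegree, card_eq_of_equiv e]
    exact hdeg
  refine hv (funext fun i => ?_)
  rw [← hco i, hP0]; simp

/-- The matrix whose row `j` holds the coefficients of the remainder of `X ^ j` modulo `Q`. -/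
def remMatrix (n r : ℕ) (Q : ℂ[X]) : Matrix (Fin n) (Fin r) ℂ :=
  Matrix.of fun j i => (X ^ (j : ℕ) %ₘ Q).coeff i

/-- Each column is a functional vanishing on multiples of `rootPoly s`, so `X ^ j` may be replaced
by its remainder, which involves only the first `r` rows. -/
lemma kMatrix_eq_remMatrix_mul {r : ℕ} {s : Multiset ℂ} (hs : (0 : ℂ) ∉ s)
    (e : Fin r ≃ s.ToType) (n : ℕ) :
    (kMatrix n s).submatrix id e
      = remMatrix n r (rootPoly s) * (kMatrix r s).submatrix id e := by
  ext j c
  have hdeg : ((X : ℂ[X]) ^ (j : ℕ) %ₘ rootPoly s).degree < r := by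
    have := degree_modByMonic_lt ((X : ℂ[X]) ^ (j : ℕ)) (rootPoly_monic s)
    rwa [degree_eq_natDegree (rootPoly_monic s).ne_zero, rootPoly_natDegree,
      card_eq_of_equiv e] at this
  have hdvd : rootPoly s ∣ X ^ (j : ℕ) - X ^ (j : ℕ) %ₘ rootPoly s := by
    refine ⟨X ^ (j : ℕ) /ₘ rootPoly s, ?_⟩
    rw [sub_eq_iff_eq_add, add_comm, modByMonic_add_div]
  have h := (rootPoly_dvd_iff hs _).1 hdvd (e c)
  rw [euler_iterate_sub, eval_sub, sub_eq_zero, eval_euler_iterate_X_pow,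
    eval_euler_iterate hdeg] at h
  simpa [kMatrix, remMatrix, Matrix.mul_apply] using h

/-- `K_{0,r-1}` factors out on the right of both terms. What is left depends on the roots only
through the coefficients of `rootPoly`. -/
lemma klDet_div_eq {r p m : ℕ} {a : ℤ → ℂ} (b : Matrix (Fin r) (Fin m) ℂ) {z : ℂ}
    (hs : (0 : ℂ) ∉ stableRoots r p a z) (e : Fin r ≃ (stableRoots r p a z).ToType) :
    klDet r p m a b z e / (kMat r p a z e r).det
      = (z • (1 : Matrix (Fin r) (Fin r) ℂ)
          - boundaryMatrix r p m a b * remMatrix m r (rootPoly (stableRoots r p a z))).det := by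
  have hne : (kMat r p a z e r).det ≠ 0 := kMatrix_det_ne_zero hs e
  rw [div_eq_iff hne, klDet, ← Matrix.det_mul, Matrix.sub_mul, Matrix.smul_mul, Matrix.one_mul,
    Matrix.mul_assoc]
  congr 3
  exact congrArg _ (kMatrix_eq_remMatrix_mul hs e m)

lemma intrinsicDet_eq {r p m : ℕ} {a : ℤ → ℂ} (b : Matrix (Fin r) (Fin m) ℂ) {z : ℂ}
    (hs : (0 : ℂ) ∉ stableRoots r p a z) (hcard : (stableRoots r p a z).card = r) :
    intrinsicDet r p m a b z
      = (z • (1 : Matrix (Fin r) (Fin r) ℂ)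
          - boundaryMatrix r p m a b * remMatrix m r (rootPoly (stableRoots r p a z))).det := by
  have hne : Nonempty (Fin r ≃ (stableRoots r p a z).ToType) :=
    ⟨(Fintype.equivFinOfCardEq (by rw [Multiset.card_coe, hcard])).symm⟩
  rw [intrinsicDet, dif_pos hne, klDet_div_eq b hs]

/-! ### Dependence of remainders on the divisor -/

/-- Multiplying a remainder by `X` gives degree at most `r`, and one multiple of `Q` removes the top
term. This recursion makes remainders polynomial in the coefficients of `Q`. -/
lemma X_pow_succ_modByMonic {Q : ℂ[X]} (hQ : Q.Monic) {r : ℕ} (hr : 1 ≤ r)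
    (hd : Q.natDegree = r) (j : ℕ) :
    X ^ (j + 1) %ₘ Q
      = X * (X ^ j %ₘ Q) - C ((X ^ j %ₘ Q).coeff (r - 1)) * Q := by
  have hlt : ((X : ℂ[X]) ^ j %ₘ Q).degree < r := by
    have := degree_modByMonic_lt ((X : ℂ[X]) ^ j) hQ
    rwa [degree_eq_natDegree hQ.ne_zero, hd] at this
  set R := (X : ℂ[X]) ^ j %ₘ Q with hR
  refine (div_modByMonic_unique (X * (X ^ j /ₘ Q) + C (R.coeff (r - 1))) _ hQ ⟨?_, ?_⟩).2
  · have := modByMonic_add_div ((X : ℂ[X]) ^ j) Q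
    rw [← hR] at this
    calc X * R - C (R.coeff (r - 1)) * Q + Q * (X * (X ^ j /ₘ Q) + C (R.coeff (r - 1)))
        = X * (R + Q * (X ^ j /ₘ Q)) := by ring
      _ = X ^ (j + 1) := by rw [this]; ring
  · rw [degree_eq_natDegree hQ.ne_zero, hd, degree_lt_iff_coeff_zero]
    rw [degree_lt_iff_coeff_zero] at hlt
    intro n hn
    obtain ⟨n, rfl⟩ : ∃ k, n = k + 1 := ⟨n - 1, by omega⟩
    rw [coeff_sub, coeff_X_mul, coeff_C_mul]
    rcases hn.lt_or_eq with h | h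
    · have h0 : Q.coeff (n + 1) = 0 := coeff_eq_zero_of_natDegree_lt (by omega)
      rw [hlt n (by omega), h0]; simp
    · have h1 : Q.coeff (n + 1) = 1 := by rw [← h, ← hd]; exact hQ
      rw [h1, h]; simp

lemma X_pow_succ_modByMonic_coeff {Q : ℂ[X]} (hQ : Q.Monic) {r : ℕ} (hr : 1 ≤ r)
    (hd : Q.natDegree = r) (j i : ℕ) :
    (X ^ (j + 1) %ₘ Q).coeff i
      = (if i = 0 then 0 else (X ^ j %ₘ Q).coeff (i - 1))
        - (X ^ j %ₘ Q).coeff (r - 1) * Q.coeff i := by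
  rw [X_pow_succ_modByMonic hQ hr hd, coeff_sub, coeff_C_mul]
  cases i <;> simp

lemma one_modByMonic {Q : ℂ[X]} (hQ : Q.Monic) {r : ℕ} (hr : 1 ≤ r)
    (hd : Q.natDegree = r) : (1 : ℂ[X]) %ₘ Q = 1 := by
  rw [modByMonic_eq_self_iff hQ, degree_one, degree_eq_natDegree hQ.ne_zero, hd]
  exact_mod_cast hr

lemma tendsto_X_pow_modByMonic_coeff {α : Type*} {F : Filter α} {Q : α → ℂ[X]} {Q₀ : ℂ[X]}
    {r : ℕ} (hr : 1 ≤ r) (hQ : ∀ᶠ x in F, (Q x).Monic ∧ (Q x).natDegree = r)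
    (hQ₀ : Q₀.Monic) (hd₀ : Q₀.natDegree = r)
    (h : ∀ i, Tendsto (fun x => (Q x).coeff i) F (𝓝 (Q₀.coeff i))) (j i : ℕ) :
    Tendsto (fun x => (X ^ j %ₘ Q x).coeff i) F (𝓝 ((X ^ j %ₘ Q₀).coeff i)) := by
  induction j generalizing i with
  | zero =>
    refine tendsto_const_nhds.congr' ?_
    filter_upwards [hQ] with x hx
    rw [pow_zero, one_modByMonic hx.1 hr hx.2, one_modByMonic hQ₀ hr hd₀]
  | succ j ih =>
    rw [X_pow_succ_modByMonic_coeff hQ₀ hr hd₀]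
    refine Tendsto.congr' (f₁ := fun x => (if i = 0 then 0 else (X ^ j %ₘ Q x).coeff (i - 1))
        - (X ^ j %ₘ Q x).coeff (r - 1) * (Q x).coeff i) ?_ ?_
    · filter_upwards [hQ] with x hx
      rw [X_pow_succ_modByMonic_coeff hx.1 hr hx.2]
    · refine Tendsto.sub ?_ ((ih _).mul (h i))
      split_ifs
      · exact tendsto_const_nhds
      · exact ih _

lemma differentiableOn_X_pow_modByMonic_coeff {Q : ℂ → ℂ[X]} {U : Set ℂ}
    {r : ℕ} (hr : 1 ≤ r) (hQ : ∀ x ∈ U, (Q x).Monic ∧ (Q x).natDegree = r)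
    (h : ∀ i, DifferentiableOn ℂ (fun x => (Q x).coeff i) U) (j i : ℕ) :
    DifferentiableOn ℂ (fun x => (X ^ j %ₘ Q x).coeff i) U := by
  induction j generalizing i with
  | zero =>
    refine (differentiableOn_const ((1 : ℂ[X]).coeff i)).congr fun x hx => ?_
    rw [pow_zero, one_modByMonic (hQ x hx).1 hr (hQ x hx).2]
  | succ j ih =>
    refine DifferentiableOn.congr (f := fun x => (if i = 0 then 0 else
      (X ^ j %ₘ Q x).coeff (i - 1)) - (X ^ j %ₘ Q x).coeff (r - 1) * (Q x).coeff i) ?_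
      fun x hx => X_pow_succ_modByMonic_coeff (hQ x hx).1 hr (hQ x hx).2 j i
    refine DifferentiableOn.sub ?_ ((ih _).mul (h i))
    split_ifs
    · exact differentiableOn_const _
    · exact ih _

/-! ### Power sums of the roots in the unit disk as circle integrals -/

open Classical in
/-- The roots of `P` in the open unit disk, with multiplicity. -/
def diskRoots (P : ℂ[X]) : Multiset ℂ := P.roots.filter fun κ => ‖κ‖ < 1

/-- Cauchy's formula for a pole inside the circle, Cauchy's theorem for a pole outside. -/
lemma circleIntegral_pow_div_sub (k : ℕ) {w : ℂ} (hw : ‖w‖ ≠ 1) :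
    (∮ x in C(0, 1), x ^ k * (1 / (x - w)))
      = 2 * Real.pi * Complex.I * (if ‖w‖ < 1 then w ^ k else 0) := by
  split_ifs with h
  · have hd : DiffContOnCl ℂ (fun x : ℂ => x ^ k) (Metric.ball 0 1) :=
      (differentiable_id.pow k).diffContOnCl
    have := hd.circleIntegral_sub_inv_smul (w := w) (by simpa using h)
    simpa [div_eq_mul_inv, mul_comm] using this
  · have hd : DiffContOnCl ℂ (fun x : ℂ => x ^ k * (1 / (x - w))) (Metric.ball 0 1) := by
      refine DifferentiableOn.diffContOnCl ?_
      rw [closure_ball _ one_ne_zero]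
      intro x hx
      have hne : x - w ≠ 0 := by
        rw [sub_ne_zero]
        rintro rfl
        exact hw (le_antisymm (by simpa using hx) (not_lt.1 h))
      have : DifferentiableAt ℂ (fun x : ℂ => x ^ k * (1 / (x - w))) x := by
        fun_prop (disch := exact hne)
      exact this.differentiableWithinAt
    rw [hd.circleIntegral_eq_zero zero_le_one, mul_zero]

lemma circleIntegrable_pow_div_sub (k : ℕ) {w : ℂ} (hw : ‖w‖ ≠ 1) :
    CircleIntegrable (fun x => x ^ k * (1 / (x - w))) 0 1 := by
  refine ContinuousOn.circleIntegrable zero_le_one fun x hx => ?_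
  have hne : x - w ≠ 0 := by
    rw [sub_ne_zero]
    rintro rfl
    exact hw (by simpa using hx)
  have : ContinuousAt (fun x : ℂ => x ^ k * (1 / (x - w))) x := by fun_prop (disch := exact hne)
  exact this.continuousWithinAt

lemma circleIntegral_sum_pow_div_sub (k : ℕ) (s : Multiset ℂ) (hs : ∀ w ∈ s, ‖w‖ ≠ 1) :
    CircleIntegrable (fun x => x ^ k * (s.map fun w => 1 / (x - w)).sum) 0 1 ∧
    (∮ x in C(0, 1), x ^ k * (s.map fun w => 1 / (x - w)).sum)
      = 2 * Real.pi * Complex.I * (s.map fun w => if ‖w‖ < 1 then w ^ k else 0).sum := by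
  induction s using Multiset.induction with
  | empty => simp [circleIntegral]
  | cons w s ih =>
    obtain ⟨ih1, ih2⟩ := ih fun x hx => hs x (Multiset.mem_cons_of_mem hx)
    have hw := hs w (Multiset.mem_cons_self w s)
    have hi := circleIntegrable_pow_div_sub k hw
    simp only [Multiset.map_cons, Multiset.sum_cons, mul_add]
    refine ⟨hi.add ih1, ?_⟩
    rw [circleIntegral.integral_add hi ih1, ih2, circleIntegral_pow_div_sub k hw]

/-- `P'/P` is the sum of `1 / (x - w)` over all roots `w`, and the integral keeps only those in the
disk. The case `k = 0` counts roots. -/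
lemma sum_pow_diskRoots (k : ℕ) (P : ℂ[X]) (hP : ∀ x : ℂ, ‖x‖ = 1 → P.eval x ≠ 0) :
    ((diskRoots P).map fun w => w ^ k).sum
      = (2 * Real.pi * Complex.I)⁻¹ *
          ∮ x in C(0, 1), x ^ k * ((derivative P).eval x / P.eval x) := by
  classical
  have hs : ∀ w ∈ P.roots, ‖w‖ ≠ 1 := fun w hw h => hP w h (isRoot_of_mem_roots hw)
  have h1 : (∮ x in C(0, 1), x ^ k * ((derivative P).eval x / P.eval x))
      = ∮ x in C(0, 1), x ^ k * (P.roots.map fun w => 1 / (x - w)).sum := by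
    refine circleIntegral.integral_congr zero_le_one fun x hx => ?_
    have := (IsAlgClosed.splits P).eval_derivative_div_eval_of_ne_zero
      (hP x (by simpa using hx))
    simp only [this]
  rw [h1, (circleIntegral_sum_pow_div_sub k _ hs).2, inv_mul_cancel_left₀ Complex.two_pi_I_ne_zero,
    diskRoots]
  generalize P.roots = s
  induction s using Multiset.induction with
  | empty => simp
  | cons w s ih =>
    by_cases h : ‖w‖ < 1
    · simp [h, ← ih]
    · simp [h, ← ih]

/-! ### The polynomials `u A - X ^ r` for `|u| < 1` -/

/-- The polynomial `u A - X ^ r`. -/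
def pencil (A : ℂ[X]) (r : ℕ) (u : ℂ) : ℂ[X] := C u * A - X ^ r

section pencil

variable {A : ℂ[X]} {r : ℕ}

lemma pencil_eval (u x : ℂ) : (pencil A r u).eval x = u * A.eval x - x ^ r := by
  simp [pencil]

lemma le_norm_pencil_eval (hA : ∀ x : ℂ, ‖x‖ = 1 → ‖A.eval x‖ ≤ 1) (u : ℂ) {x : ℂ}
    (hx : ‖x‖ = 1) : 1 - ‖u‖ ≤ ‖(pencil A r u).eval x‖ := by
  rw [pencil_eval, norm_sub_rev]
  have h1 := norm_sub_norm_le (x ^ r) (u * A.eval x)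
  rw [norm_pow, hx, one_pow, norm_mul] at h1
  have h2 := mul_le_mul_of_nonneg_left (hA x hx) (norm_nonneg u)
  linarith

lemma pencil_eval_ne_zero (hA : ∀ x : ℂ, ‖x‖ = 1 → ‖A.eval x‖ ≤ 1) {u : ℂ} (hu : ‖u‖ < 1)
    {x : ℂ} (hx : ‖x‖ = 1) : (pencil A r u).eval x ≠ 0 := by
  have := le_norm_pencil_eval (r := r) hA u hx
  exact norm_pos_iff.1 (by linarith)

lemma hasDerivAt_pencil_eval (u x : ℂ) :
    HasDerivAt (fun u => (pencil A r u).eval x) (A.eval x) u := by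
  simp only [pencil_eval]
  simpa using ((hasDerivAt_id u).mul_const (A.eval x)).sub_const (x ^ r)

lemma hasDerivAt_pencil_derivative_eval (u x : ℂ) :
    HasDerivAt (fun u => (derivative (pencil A r u)).eval x) ((derivative A).eval x) u := by
  have h : ∀ u, (derivative (pencil A r u)).eval x
      = u * (derivative A).eval x - (derivative (X ^ r : ℂ[X])).eval x := by
    intro u
    simp only [pencil, derivative_sub, derivative_C_mul, eval_sub, eval_mul, eval_C]
  simp only [h]
  simpa using ((hasDerivAt_id u).mul_const ((derivative A).eval x)).sub_const
    ((derivative (X ^ r : ℂ[X])).eval x)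

/-- Differentiation under the integral sign; the denominator is at least `1 - ρ` in modulus for `|u|
< ρ < 1`. -/
lemma differentiableOn_circleIntegral_pencil (hA : ∀ x : ℂ, ‖x‖ = 1 → ‖A.eval x‖ ≤ 1) (k : ℕ) :
    DifferentiableOn ℂ (fun u => ∮ x in C(0, 1),
      x ^ k * ((derivative (pencil A r u)).eval x / (pencil A r u).eval x)) (Metric.ball 0 1) := by
  intro u₀ hu₀
  have hu₀' : ‖u₀‖ < 1 := by simpa using hu₀
  obtain ⟨ρ, hρ₀, hρ⟩ := exists_between hu₀'
  -- Numerator of the `u`-derivative of the quotient. Its terms in `u` cancel, so a bound at `u = 0`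
  -- serves for all `u`.
  set N : ℂ → ℂ → ℂ := fun u x => (derivative A).eval x * (pencil A r u).eval x
    - (derivative (pencil A r u)).eval x * A.eval x with hN
  have hc : ∀ θ : ℝ, ‖circleMap 0 1 θ‖ = 1 := fun x => by simp
  have hNu : ∀ u x, N u x = N 0 x := by
    intro u x
    simp only [hN, pencil, derivative_sub, derivative_C_mul, eval_sub, eval_mul, eval_C]
    ring
  have hNc : Continuous (N 0) := by
    simp only [hN]
    fun_prop
  have hcont : ∀ u : ℂ, ‖u‖ < 1 → Continuous fun θ : ℝ =>
      deriv (circleMap 0 1) θ • (circleMap 0 1 θ ^ k *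
        ((derivative (pencil A r u)).eval (circleMap 0 1 θ)
          / (pencil A r u).eval (circleMap 0 1 θ))) := by
    intro u hu
    have hm : Continuous (circleMap (0 : ℂ) 1) := continuous_circleMap 0 1
    simp only [deriv_circleMap]
    refine (hm.mul continuous_const).smul ((hm.pow k).mul (Continuous.div ?_ ?_ ?_))
    · exact (derivative (pencil A r u)).continuous.comp hm
    · exact (pencil A r u).continuous.comp hm
    · exact fun θ => pencil_eval_ne_zero hA hu (hc θ)
  have hcont' : Continuous fun θ : ℝ =>
      deriv (circleMap 0 1) θ • (circleMap 0 1 θ ^ k *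
        (N u₀ (circleMap 0 1 θ) / (pencil A r u₀).eval (circleMap 0 1 θ) ^ 2)) := by
    have hm : Continuous (circleMap (0 : ℂ) 1) := continuous_circleMap 0 1
    simp only [deriv_circleMap, hNu u₀]
    refine (hm.mul continuous_const).smul ((hm.pow k).mul (Continuous.div ?_ ?_ ?_))
    · exact hNc.comp hm
    · exact ((pencil A r u₀).continuous.comp hm).pow 2
    · exact fun θ => pow_ne_zero _ (pencil_eval_ne_zero hA hu₀' (hc θ))
  have hnhds : Metric.ball (0 : ℂ) ρ ∈ 𝓝 u₀ := Metric.isOpen_ball.mem_nhds (by simpa using hρ₀)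
  have key := intervalIntegral.hasDerivAt_integral_of_dominated_loc_of_deriv_le
    (μ := MeasureTheory.volume) (a := 0) (b := 2 * Real.pi) (𝕜 := ℂ) (x₀ := u₀)
    (s := Metric.ball 0 ρ)
    (F := fun u θ => deriv (circleMap 0 1) θ • (circleMap 0 1 θ ^ k *
        ((derivative (pencil A r u)).eval (circleMap 0 1 θ)
          / (pencil A r u).eval (circleMap 0 1 θ))))
    (F' := fun u θ => deriv (circleMap 0 1) θ • (circleMap 0 1 θ ^ k *
        (N u (circleMap 0 1 θ) / (pencil A r u).eval (circleMap 0 1 θ) ^ 2)))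
    (bound := fun θ => ‖N 0 (circleMap 0 1 θ)‖ / (1 - ρ) ^ 2)
    hnhds ?_ ((hcont u₀ hu₀').intervalIntegrable _ _) hcont'.aestronglyMeasurable ?_ ?_ ?_
  · exact key.2.differentiableAt.differentiableWithinAt
  · filter_upwards [hnhds] with u hu
    exact (hcont u ((by simpa using hu : ‖u‖ < ρ).trans hρ)).aestronglyMeasurable
  · refine Eventually.of_forall fun θ _ u hu => ?_
    have hu' : ‖u‖ < ρ := by simpa using hu
    rw [norm_smul, norm_mul, norm_div, norm_pow, norm_pow, hc, deriv_circleMap, norm_mul, hc,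
      Complex.norm_I, hNu u]
    simp only [one_pow, one_mul]
    have := le_norm_pencil_eval (r := r) hA u (hc θ)
    have h1 : 0 < 1 - ρ := by linarith
    gcongr
    linarith
  · refine Continuous.intervalIntegrable ?_ _ _
    exact (hNc.comp (continuous_circleMap 0 1)).norm.div_const _
  · refine Eventually.of_forall fun θ _ u hu => ?_
    have hu' : ‖u‖ < 1 := (by simpa using hu : ‖u‖ < ρ).trans hρ
    simp only [smul_eq_mul]
    refine HasDerivAt.const_mul _ (HasDerivAt.const_mul _ ?_)
    exact (hasDerivAt_pencil_derivative_eval u _).div (hasDerivAt_pencil_eval u _)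
      (pencil_eval_ne_zero hA hu' (hc θ))

lemma differentiableOn_sum_pow_diskRoots (hA : ∀ x : ℂ, ‖x‖ = 1 → ‖A.eval x‖ ≤ 1) (k : ℕ) :
    DifferentiableOn ℂ (fun u => ((diskRoots (pencil A r u)).map fun w => w ^ k).sum)
      (Metric.ball 0 1) :=
  ((differentiableOn_circleIntegral_pencil hA k).const_mul (2 * Real.pi * Complex.I)⁻¹).congr
    fun u hu => sum_pow_diskRoots k _ fun _ hx => pencil_eval_ne_zero hA (by simpa using hu) hx

/-- The zeroth power sum is continuous and integer-valued on the connected disk, hence constant; at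
`u = 0` the polynomial is `-X ^ r`. -/
lemma card_diskRoots (hA : ∀ x : ℂ, ‖x‖ = 1 → ‖A.eval x‖ ≤ 1) {u : ℂ} (hu : ‖u‖ < 1) :
    (diskRoots (pencil A r u)).card = r := by
  have hcont : ContinuousOn (fun u => ((diskRoots (pencil A r u)).card : ℂ)) (Metric.ball 0 1) := by
    have := (differentiableOn_sum_pow_diskRoots (r := r) hA 0).continuousOn
    simpa using this
  have hcont' : ContinuousOn (fun u => (diskRoots (pencil A r u)).card) (Metric.ball (0 : ℂ) 1) := by
    rw [Nat.isClosedEmbedding_coe_real.isEmbedding.continuousOn_iff]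
    exact (Complex.continuous_re.comp_continuousOn hcont).congr fun u _ => by simp
  have h0 : (diskRoots (pencil A r 0)).card = r := by
    simp [diskRoots, pencil, Multiset.filter_eq_self.2]
  have hu' : u ∈ Metric.ball (0 : ℂ) 1 := by simpa using hu
  have h0' : (0 : ℂ) ∈ Metric.ball (0 : ℂ) 1 := by simp
  have hpre : IsPreconnected (Metric.ball (0 : ℂ) 1) := (convex_ball (0 : ℂ) 1).isPreconnected
  have h := hpre.constant hcont' hu' h0'
  exact h.trans h0

lemma multiset_newton (s : Multiset ℂ) (k : ℕ) :
    (k : ℂ) * s.esymm k = (-1) ^ (k + 1) *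
      ∑ c ∈ Finset.HasAntidiagonal.antidiagonal k with c.1 < k,
        (-1) ^ c.1 * s.esymm c.1 * (s.map fun w => w ^ c.2).sum := by
  obtain ⟨l, rfl⟩ : ∃ l : List ℂ, (l : Multiset ℂ) = s := Quot.exists_rep s
  have hl : (l : Multiset ℂ) = (Finset.univ.val.map l.get : Multiset ℂ) := by
    simp
  rw [hl]
  have h := congrArg (MvPolynomial.aeval (R := ℂ) l.get)
    (MvPolynomial.mul_esymm_eq_sum (Fin l.length) ℂ k)
  simp only [map_mul, map_natCast, map_pow, map_neg, map_one, map_sum,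
    MvPolynomial.aeval_esymm_eq_multiset_esymm, MvPolynomial.psum, MvPolynomial.aeval_X] at h
  rw [h]
  simp only [Multiset.map_map, Function.comp_def, Finset.sum_map_val]

/-- Newton's identities express `k e_k` through the power sums and the `e_i` with `i < k`; division
by `k` is harmless over `ℂ`. -/
lemma differentiableOn_esymm_diskRoots (hA : ∀ x : ℂ, ‖x‖ = 1 → ‖A.eval x‖ ≤ 1) (k : ℕ) :
    DifferentiableOn ℂ (fun u => (diskRoots (pencil A r u)).esymm k) (Metric.ball 0 1) := by
  induction k using Nat.strong_induction_on with
  | _ k ih =>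
    rcases Nat.eq_zero_or_pos k with rfl | hk
    · simp [Multiset.esymm]
    · have hk' : (k : ℂ) ≠ 0 := by exact_mod_cast hk.ne'
      have : ∀ s : Multiset ℂ, s.esymm k = (k : ℂ)⁻¹ * ((-1) ^ (k + 1) *
          ∑ c ∈ Finset.HasAntidiagonal.antidiagonal k with c.1 < k,
            (-1) ^ c.1 * s.esymm c.1 * (s.map fun w => w ^ c.2).sum) := by
        intro s
        rw [← multiset_newton, inv_mul_cancel_left₀ hk']
      simp only [this]
      refine DifferentiableOn.const_mul (DifferentiableOn.const_mul
        (DifferentiableOn.fun_sum fun c hc => ?_) _) _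
      refine DifferentiableOn.mul ((ih c.1 (Finset.mem_filter.1 hc).2).const_mul _) ?_
      exact differentiableOn_sum_pow_diskRoots hA c.2

lemma differentiableOn_rootPoly_diskRoots_coeff (hA : ∀ x : ℂ, ‖x‖ = 1 → ‖A.eval x‖ ≤ 1)
    (i : ℕ) :
    DifferentiableOn ℂ (fun u => (rootPoly (diskRoots (pencil A r u))).coeff i)
      (Metric.ball 0 1) := by
  rcases le_or_gt i r with h | h
  · refine ((differentiableOn_esymm_diskRoots (r := r) hA (r - i)).const_mul
      ((-1) ^ (r - i))).congr fun u hu => ?_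
    have hcard := card_diskRoots (r := r) hA (by simpa using hu : ‖u‖ < 1)
    rw [rootPoly, Multiset.prod_X_sub_C_coeff _ (by rw [hcard]; exact h), hcard]
  · refine (differentiableOn_const (0 : ℂ)).congr fun u hu => ?_
    have hcard := card_diskRoots (r := r) hA (by simpa using hu : ‖u‖ < 1)
    exact coeff_eq_zero_of_natDegree_lt (by rw [rootPoly_natDegree, hcard]; exact h)

end pencil

/-! ### Limits of multisets of roots -/

/-- Near `x` the values of `f` lie in disjoint neighbourhoods of the finitely many cluster values.
The image of a small convex piece of `U` is connected, so it stays in one of them. -/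
lemma exists_tendsto_of_finite_limits {E : Type*} [TopologicalSpace E] [T2Space E] {U : Set ℂ}
    (hU : Convex ℝ U) {x : ℂ} [NeBot (𝓝[U] x)] {f : ℂ → E} (hf : ContinuousOn f U) {S : Set E}
    (hS : S.Finite)
    (h : ∀ g : Ultrafilter ℂ, ↑g ≤ 𝓝[U] x → ∃ s ∈ S, Tendsto f g (𝓝 s)) :
    ∃ s ∈ S, Tendsto f (𝓝[U] x) (𝓝 s) := by
  have hev : ∀ V : Set E, (∀ s ∈ S, V ∈ 𝓝 s) → ∀ᶠ y in 𝓝[U] x, f y ∈ V := by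
    intro V hV
    refine mem_iff_ultrafilter.2 fun g hg => ?_
    obtain ⟨s, hs, hsf⟩ := h g hg
    exact hsf (hV s hs)
  obtain ⟨V, hV, hdisj⟩ := hS.t2_separation
  have h1 := hev (⋃ s ∈ S, V s) fun s hs =>
    mem_of_superset ((hV s).2.mem_nhds (hV s).1) (Set.subset_biUnion_of_mem hs)
  obtain ⟨δ, hδ, hball⟩ := Metric.mem_nhdsWithin_iff.1 h1
  have hW : Metric.ball x δ ∩ U ∈ 𝓝[U] x :=
    inter_mem (mem_nhdsWithin_of_mem_nhds (Metric.ball_mem_nhds x hδ)) self_mem_nhdsWithin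
  obtain ⟨y, hy⟩ := nonempty_of_mem hW
  obtain ⟨s, hs, hys⟩ := Set.mem_iUnion₂.1 (hball hy)
  have hpre : IsPreconnected (f '' (Metric.ball x δ ∩ U)) :=
    ((convex_ball x δ).inter hU).isPreconnected.image f (hf.mono Set.inter_subset_right)
  have hother : IsOpen (⋃ t ∈ S \ {s}, V t) := isOpen_biUnion fun t _ => (hV t).2
  have hd : Disjoint (V s) (⋃ t ∈ S \ {s}, V t) := by
    rw [Set.disjoint_iUnion₂_right]
    exact fun t ht => hdisj hs ht.1 fun hst => ht.2 hst.symm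
  have hsub : f '' (Metric.ball x δ ∩ U) ⊆ V s := by
    refine hpre.subset_left_of_subset_union (hV s).2 hother hd ?_ ⟨f y, ⟨y, hy, rfl⟩, hys⟩
    rintro _ ⟨w, hw, rfl⟩
    obtain ⟨t, ht, hwt⟩ := Set.mem_iUnion₂.1 (hball hw)
    by_cases hts : t = s
    · exact Or.inl (hts ▸ hwt)
    · exact Or.inr (Set.mem_biUnion (show t ∈ S \ {s} from ⟨ht, hts⟩) hwt)
  refine ⟨s, hs, fun N hN => ?_⟩
  -- The chosen neighbourhood is shrunk to an arbitrary `N`; the other ones are already excluded on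
  -- the small piece.
  have h2 := hev (N ∪ ⋃ t ∈ S \ {s}, V t) fun t ht => by
    by_cases hts : t = s
    · exact mem_of_superset (hts ▸ hN) Set.subset_union_left
    · exact mem_of_superset ((hV t).2.mem_nhds (hV t).1)
        ((Set.subset_biUnion_of_mem (show t ∈ S \ {s} from ⟨ht, hts⟩)).trans
          Set.subset_union_right)
  rw [mem_map]
  filter_upwards [h2, hW] with w hw hwW
  rcases hw with hw | hw
  · exact hw
  · exact absurd hw (Set.disjoint_left.1 hd (hsub ⟨w, hwW, rfl⟩))

lemma exists_enumeration {r : ℕ} {s : Multiset ℂ} (hs : s.card = r) :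
    ∃ v : Fin r → ℂ, s = Finset.univ.val.map v := by
  obtain ⟨l, rfl⟩ : ∃ l : List ℂ, (l : Multiset ℂ) = s := Quot.exists_rep s
  obtain rfl : l.length = r := by simpa using hs
  exact ⟨l.get, by simp⟩

lemma continuous_prod_X_sub_C_coeff {ι : Type*} (s : Finset ι) (j : ℕ) :
    Continuous fun v : ι → ℂ => (∏ i ∈ s, (X - C (v i))).coeff j := by
  classical
  induction s using Finset.induction_on generalizing j with
  | empty => simpa using continuous_const
  | insert i s hi ih =>
    simp only [Finset.prod_insert hi, sub_mul, coeff_sub, coeff_C_mul]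
    refine Continuous.sub ?_ ((continuous_apply i).mul (ih j))
    cases j with
    | zero => simpa using continuous_const
    | succ j => simpa only [coeff_X_mul] using ih j

lemma rootPoly_map_univ {r : ℕ} (v : Fin r → ℂ) :
    rootPoly (Finset.univ.val.map v) = ∏ i, (X - C (v i)) := by
  simp [rootPoly, Function.comp_def, Finset.prod]

/-- The roots are enumerated arbitrarily, and compactness of the `r`-fold product of closed disks
gives a limit along the ultrafilter; no continuous choice of enumeration is needed. -/
lemma exists_limit_multiset {α : Type*} (g : Ultrafilter α) {r : ℕ} {s : α → Multiset ℂ}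
    (hs : ∀ᶠ x in (g : Filter α), (s x).card = r ∧ ∀ κ ∈ s x, ‖κ‖ ≤ 1) :
    ∃ t : Multiset ℂ, t.card = r ∧
      (∀ i, Tendsto (fun x => (rootPoly (s x)).coeff i) g (𝓝 ((rootPoly t).coeff i))) ∧
      ∀ ε : ℝ, 0 < ε → ∀ᶠ x in (g : Filter α),
        Multiset.Rel (fun κ κ' : ℂ => ‖κ - κ'‖ < ε) (s x) t := by
  have hex : ∀ x, ∃ v : Fin r → ℂ, (s x).card = r → s x = Finset.univ.val.map v := by
    intro x
    by_cases h : (s x).card = r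
    · obtain ⟨v, hv⟩ := exists_enumeration h
      exact ⟨v, fun _ => hv⟩
    · exact ⟨0, fun h' => absurd h' h⟩
  choose v hv using hex
  have hcomp : IsCompact (Set.univ.pi fun _ : Fin r => Metric.closedBall (0 : ℂ) 1) :=
    isCompact_univ_pi fun _ => isCompact_closedBall 0 1
  obtain ⟨y, -, hy⟩ := hcomp.ultrafilter_le_nhds' (g.map v) (by
    rw [Ultrafilter.mem_map]
    filter_upwards [hs] with x hx i _
    have : v x i ∈ s x := by
      rw [hv x hx.1]
      exact Multiset.mem_map_of_mem _ (Finset.mem_univ i)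
    simpa using hx.2 _ this)
  have hy' : Tendsto v g (𝓝 y) := hy
  refine ⟨Finset.univ.val.map y, by simp, fun i => ?_, fun ε hε => ?_⟩
  · have := ((continuous_prod_X_sub_C_coeff Finset.univ i).tendsto y).comp hy'
    rw [rootPoly_map_univ]
    refine this.congr' ?_
    filter_upwards [hs] with x hx
    rw [Function.comp_apply, ← rootPoly_map_univ, ← hv x hx.1]
  · have : ∀ᶠ x in (g : Filter α), ∀ i, ‖v x i - y i‖ < ε := by
      rw [eventually_all]
      intro i
      have := (tendsto_pi_nhds.1 hy' i).eventually (Metric.ball_mem_nhds _ hε)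
      simpa [dist_eq_norm] using this
    filter_upwards [this, hs] with x hx hx'
    rw [hv x hx'.1, Multiset.rel_map]
    exact Multiset.rel_refl_of_refl_on fun i _ => hx i

lemma rootPoly_injective : Function.Injective rootPoly := fun s t h => by
  rw [← rootPoly_roots s, h, rootPoly_roots]

/-- Continuity of roots in the coefficients: along any ultrafilter a limit multiset exists, and its
root polynomial must be that of `t`. -/
lemma eventually_rel_of_tendsto_coeff {α : Type*} {F : Filter α} {r : ℕ} {s : α → Multiset ℂ}
    (hs : ∀ᶠ x in F, (s x).card = r ∧ ∀ κ ∈ s x, ‖κ‖ ≤ 1) {t : Multiset ℂ}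
    (ht : ∀ i, Tendsto (fun x => (rootPoly (s x)).coeff i) F (𝓝 ((rootPoly t).coeff i)))
    {ε : ℝ} (hε : 0 < ε) :
    ∀ᶠ x in F, Multiset.Rel (fun κ κ' : ℂ => ‖κ - κ'‖ < ε) (s x) t := by
  refine mem_iff_ultrafilter.2 fun g hg => ?_
  obtain ⟨t', -, ht', hrel⟩ := exists_limit_multiset g (hs.filter_mono hg)
  have : t' = t := rootPoly_injective (Polynomial.ext fun i =>
    tendsto_nhds_unique (ht' i) ((ht i).mono_left hg))
  exact this ▸ hrel ε hε

/-- Once `ε` is below every positive distance between elements of `s` and `t`, matched elements are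
equal. -/
lemma multiset_eq_of_rel_lt {s t : Multiset ℂ}
    (h : ∀ ε : ℝ, 0 < ε → Multiset.Rel (fun κ κ' : ℂ => ‖κ - κ'‖ < ε) s t) : s = t := by
  classical
  have hev : ∀ᶠ ε : ℝ in 𝓝[>] 0, ∀ a ∈ s.toFinset, ∀ b ∈ t.toFinset, ‖a - b‖ < ε → a = b := by
    simp only [Filter.eventually_all_finset]
    intro a _ b _
    by_cases hab : a = b
    · exact Eventually.of_forall fun _ _ => hab
    · have : 0 < ‖a - b‖ := norm_pos_iff.2 (sub_ne_zero.2 hab)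
      filter_upwards [mem_nhdsWithin_of_mem_nhds (Iio_mem_nhds this)] with ε hε hlt
      exact absurd hlt (not_lt.2 (le_of_lt hε))
  obtain ⟨ε, hε, hpos⟩ := (hev.and self_mem_nhdsWithin).exists
  rw [← Multiset.rel_eq]
  exact (h ε hpos).mono fun a ha b hb hab =>
    hε a (Multiset.mem_toFinset.2 ha) b (Multiset.mem_toFinset.2 hb) hab

lemma multiset_rel_triangle {u s t : Multiset ℂ} {ε : ℝ}
    (hs : Multiset.Rel (fun κ κ' : ℂ => ‖κ - κ'‖ < ε) u s)
    (ht : Multiset.Rel (fun κ κ' : ℂ => ‖κ - κ'‖ < ε) u t) :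
    Multiset.Rel (fun κ κ' : ℂ => ‖κ - κ'‖ < ε + ε) s t := by
  induction hs generalizing t with
  | zero =>
    rw [Multiset.rel_zero_left] at ht
    rw [ht]
    exact Multiset.Rel.zero
  | cons hab _ ih =>
    obtain ⟨b', t', hb', ht', rfl⟩ := Multiset.rel_cons_left.1 ht
    refine Multiset.Rel.cons ?_ (ih ht')
    rw [norm_sub_rev] at hab
    exact (norm_sub_le_norm_sub_add_norm_sub _ _ _).trans_lt (add_lt_add hab hb')

lemma ComesFromInside.unique {r p : ℕ} {a : ℤ → ℂ} {z : ℂ} [NeBot (𝓝[{w : ℂ | 1 < ‖w‖}] z)]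
    {s t : Multiset ℂ} (hs : ComesFromInside r p a z s) (ht : ComesFromInside r p a z t) :
    s = t := by
  refine multiset_eq_of_rel_lt fun ε hε => ?_
  obtain ⟨w, hw, hw'⟩ := ((hs (ε / 2) (half_pos hε)).and (ht (ε / 2) (half_pos hε))).exists
  simpa using multiset_rel_triangle hw hw'

/-! ### Boundary limits of the roots of `u A - X ^ r` -/

lemma modByMonic_coeff_eq_sum (A Q : ℂ[X]) (i : ℕ) :
    (A %ₘ Q).coeff i = ∑ j ∈ Finset.range (A.natDegree + 1), A.coeff j * (X ^ j %ₘ Q).coeff i := by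
  conv_lhs => rw [A.as_sum_range_C_mul_X_pow]
  have : ∀ P, P %ₘ Q = modByMonicHom Q P := fun _ => rfl
  simp only [this, map_sum, finsetSum_coeff, ← smul_eq_C_mul, map_smul, coeff_smul, smul_eq_mul]

lemma tendsto_modByMonic_coeff {α : Type*} {F : Filter α} {Q : α → ℂ[X]} {Q₀ : ℂ[X]}
    {r : ℕ} (hr : 1 ≤ r) (hQ : ∀ᶠ x in F, (Q x).Monic ∧ (Q x).natDegree = r)
    (hQ₀ : Q₀.Monic) (hd₀ : Q₀.natDegree = r)
    (h : ∀ i, Tendsto (fun x => (Q x).coeff i) F (𝓝 (Q₀.coeff i))) (A : ℂ[X]) (i : ℕ) :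
    Tendsto (fun x => (A %ₘ Q x).coeff i) F (𝓝 ((A %ₘ Q₀).coeff i)) := by
  simp only [modByMonic_coeff_eq_sum A]
  exact tendsto_finsetSum _ fun j _ =>
    (tendsto_X_pow_modByMonic_coeff hr hQ hQ₀ hd₀ h j i).const_mul _

section pencil

variable {A : ℂ[X]} {r : ℕ}

lemma pencil_modByMonic_coeff (u : ℂ) (Q : ℂ[X]) (i : ℕ) :
    (pencil A r u %ₘ Q).coeff i = u * (A %ₘ Q).coeff i - (X ^ r %ₘ Q).coeff i := by
  rw [pencil, sub_modByMonic, ← smul_eq_C_mul, smul_modByMonic, coeff_sub, coeff_smul, smul_eq_mul]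

/-- The value at `0` is `u A(0)`, since `X ^ r` vanishes there for `r ≥ 1`. -/
lemma zero_notMem_pencil_roots (hr : 1 ≤ r) (h0 : A.eval 0 ≠ 0) {u : ℂ} (hu : u ≠ 0) :
    pencil A r u ≠ 0 ∧ (0 : ℂ) ∉ (pencil A r u).roots := by
  have h : (pencil A r u).eval 0 ≠ 0 := by
    rw [pencil_eval, zero_pow (by omega), sub_zero]
    exact mul_ne_zero hu h0
  exact ⟨fun hp => h (by simp [hp]), fun hm => h (isRoot_of_mem_roots hm)⟩

lemma diskRoots_le_roots (P : ℂ[X]) : diskRoots P ≤ P.roots := Multiset.filter_le _ _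

lemma norm_lt_one_of_mem_diskRoots {P : ℂ[X]} {κ : ℂ} (h : κ ∈ diskRoots P) : ‖κ‖ < 1 :=
  (Multiset.mem_filter.1 h).2

lemma rootPoly_diskRoots_dvd (P : ℂ[X]) : rootPoly (diskRoots P) ∣ P := by
  by_cases hP : P = 0
  · simp [hP]
  · exact (Multiset.prod_X_sub_C_dvd_iff_le_roots hP _).2 (diskRoots_le_roots P)

lemma eventually_diskRoots (hA : ∀ x : ℂ, ‖x‖ = 1 → ‖A.eval x‖ ≤ 1) (u₀ : ℂ) :
    ∀ᶠ u in 𝓝[Metric.ball 0 1] u₀, (diskRoots (pencil A r u)).card = r ∧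
      ∀ κ ∈ diskRoots (pencil A r u), ‖κ‖ ≤ 1 := by
  filter_upwards [self_mem_nhdsWithin] with u hu
  exact ⟨card_diskRoots hA (by simpa using hu), fun κ hκ => (norm_lt_one_of_mem_diskRoots hκ).le⟩

/-- The remainder of the pencil modulo its disk factor is zero, and remainders depend continuously
on `u` and on the divisor, so the limit remainder is zero. -/
lemma rootPoly_dvd_pencil_of_tendsto (hr : 1 ≤ r) {u₀ : ℂ} {F : Filter ℂ} [NeBot F]
    (hF : F ≤ 𝓝 u₀) (hs : ∀ᶠ u in F, (diskRoots (pencil A r u)).card = r)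
    {t : Multiset ℂ} (hcard : t.card = r)
    (ht : ∀ i, Tendsto (fun u => (rootPoly (diskRoots (pencil A r u))).coeff i) F
      (𝓝 ((rootPoly t).coeff i))) :
    rootPoly t ∣ pencil A r u₀ := by
  rw [← modByMonic_eq_zero_iff_dvd (rootPoly_monic t)]
  ext i
  have hQ : ∀ᶠ u in F, (rootPoly (diskRoots (pencil A r u))).Monic ∧
      (rootPoly (diskRoots (pencil A r u))).natDegree = r :=
    hs.mono fun u hu => ⟨rootPoly_monic _, by rw [rootPoly_natDegree, hu]⟩
  have hd : (rootPoly t).natDegree = r := by rw [rootPoly_natDegree, hcard]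
  have hlim := ((tendsto_id'.2 hF).mul
    (tendsto_modByMonic_coeff hr hQ (rootPoly_monic t) hd ht A i)).sub
    (tendsto_modByMonic_coeff hr hQ (rootPoly_monic t) hd ht (X ^ r) i)
  rw [pencil_modByMonic_coeff]
  refine tendsto_nhds_unique hlim (tendsto_const_nhds.congr fun u => ?_)
  rw [id, ← pencil_modByMonic_coeff,
    (modByMonic_eq_zero_iff_dvd (rootPoly_monic _)).2 (rootPoly_diskRoots_dvd _)]

lemma exists_boundary_limit (hr : 1 ≤ r) (hA : ∀ x : ℂ, ‖x‖ = 1 → ‖A.eval x‖ ≤ 1) {u₀ : ℂ}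
    (hu₀ : ‖u₀‖ = 1) (hne : pencil A r u₀ ≠ 0) :
    ∃ t ≤ (pencil A r u₀).roots, t.card = r ∧
      ∀ i, Tendsto (fun u => (rootPoly (diskRoots (pencil A r u))).coeff i)
        (𝓝[Metric.ball 0 1] u₀) (𝓝 ((rootPoly t).coeff i)) := by
  have : NeBot (𝓝[Metric.ball (0 : ℂ) 1] u₀) := by
    rw [← mem_closure_iff_nhdsWithin_neBot, closure_ball _ one_ne_zero]
    simp [hu₀]
  -- The candidate limits are submultisets of the roots of one nonzero polynomial, hence finite in
  -- number.
  have hfin : {t : Multiset ℂ | t ≤ (pencil A r u₀).roots ∧ t.card = r}.Finite :=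
    (Set.finite_Iic (pencil A r u₀).roots).subset fun t ht => ht.1
  obtain ⟨_, ⟨t, ht, rfl⟩, htend⟩ := exists_tendsto_of_finite_limits (convex_ball (0 : ℂ) 1)
    (x := u₀) (f := fun u i => (rootPoly (diskRoots (pencil A r u))).coeff i)
    (continuousOn_pi.2 fun i => (differentiableOn_rootPoly_diskRoots_coeff hA i).continuousOn)
    (hfin.image fun t i => (rootPoly t).coeff i) (fun g hg => by
      obtain ⟨t, hcard, htend, -⟩ :=
        exists_limit_multiset g ((eventually_diskRoots hA u₀).filter_mono hg)
      refine ⟨_, ⟨t, ⟨?_, hcard⟩, rfl⟩, tendsto_pi_nhds.2 htend⟩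
      rw [← Multiset.prod_X_sub_C_dvd_iff_le_roots hne]
      exact rootPoly_dvd_pencil_of_tendsto hr (hg.trans nhdsWithin_le_nhds)
        (((eventually_diskRoots hA u₀).filter_mono hg).mono fun u hu => hu.1) hcard htend)
  exact ⟨t, ht.1, ht.2, tendsto_pi_nhds.1 htend⟩

end pencil

/-! ### Stable roots of the characteristic equation -/

/-- The polynomial `∑_{k=-r}^{p} a_k X^{r+k}`. -/
def symbolPoly (r p : ℕ) (a : ℤ → ℂ) : ℂ[X] :=
  ∑ l ∈ Finset.range (r + p + 1), C (a ((l : ℤ) - (r : ℤ))) * X ^ l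

lemma symbolPoly_eval_zero (r p : ℕ) (a : ℤ → ℂ) : (symbolPoly r p a).eval 0 = a (-(r : ℤ)) := by
  rw [symbolPoly, Finset.sum_range_succ', eval_add, eval_finsetSum]
  simp

/-- On the unit circle the polynomial and the symbol differ by a factor of modulus one, which turns
Cauchy stability into `|A| ≤ 1`. -/
lemma symbolPoly_eval_exp (r p : ℕ) (a : ℤ → ℂ) (ξ : ℝ) :
    (symbolPoly r p a).eval (Complex.exp (ξ * Complex.I))
      = Complex.exp (ξ * Complex.I) ^ r * symbol r p a ξ := by
  rw [symbolPoly, eval_finsetSum, symbol, Finset.mul_sum]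
  refine Finset.sum_nbij' (fun l => (l : ℤ) - r) (fun k => (k + r).toNat) ?_ ?_ ?_ ?_ ?_
  · intro l hl
    simp only [Finset.mem_range, Finset.mem_Icc] at *
    omega
  · intro k hk
    simp only [Finset.mem_range, Finset.mem_Icc] at *
    omega
  · intro l _
    simp
  · intro k hk
    simp only [Finset.mem_Icc] at *
    omega
  · intro l _
    rw [eval_mul, eval_C, eval_pow, eval_X, mul_left_comm, ← Complex.exp_nat_mul,
      ← Complex.exp_nat_mul, ← Complex.exp_add]
    congr 2
    push_cast
    ring

lemma norm_symbolPoly_eval_le {r p : ℕ} {a : ℤ → ℂ} (hC : CauchyStable r p a) (x : ℂ)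
    (hx : ‖x‖ = 1) : ‖(symbolPoly r p a).eval x‖ ≤ 1 := by
  have hx' : Complex.exp (x.arg * Complex.I) = x := by
    simpa [hx] using Complex.norm_mul_exp_arg_mul_I x
  rw [← hx', symbolPoly_eval_exp, hx', norm_mul, norm_pow, hx, one_pow, one_mul]
  exact hC _

section stable

variable {r p m : ℕ} {a : ℤ → ℂ}

lemma charPoly_roots_eq {z : ℂ} (hz : z ≠ 0) :
    (charPoly r p a z).roots = (pencil (symbolPoly r p a) r z⁻¹).roots := by
  have : charPoly r p a z = C z * pencil (symbolPoly r p a) r z⁻¹ := by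
    rw [charPoly, pencil, mul_sub, ← mul_assoc, ← C_mul, mul_inv_cancel₀ hz, C_1, one_mul,
      symbolPoly]
  rw [this, roots_C_mul _ hz]

lemma insideRoots_eq {z : ℂ} (hz : z ≠ 0) :
    insideRoots r p a z = diskRoots (pencil (symbolPoly r p a) r z⁻¹) := by
  rw [insideRoots, diskRoots, charPoly_roots_eq hz]

lemma ne_zero_of_one_le_norm {z : ℂ} (hz : 1 ≤ ‖z‖) : z ≠ 0 :=
  norm_pos_iff.1 (zero_lt_one.trans_le hz)

lemma neBot_nhdsWithin_one_lt_norm {z : ℂ} (hz : 1 ≤ ‖z‖) : NeBot (𝓝[{w : ℂ | 1 < ‖w‖}] z) := by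
  have h : {w : ℂ | 1 < ‖w‖} = (Metric.closedBall 0 1)ᶜ := by
    ext w
    simp
  rw [← mem_closure_iff_nhdsWithin_neBot, h, closure_compl, interior_closedBall _ one_ne_zero]
  simpa using hz

lemma tendsto_inv_nhdsWithin {z : ℂ} (hz : z ≠ 0) :
    Tendsto (fun w : ℂ => w⁻¹) (𝓝[{w : ℂ | 1 < ‖w‖}] z) (𝓝[Metric.ball 0 1] z⁻¹) := by
  refine tendsto_nhdsWithin_iff.2 ⟨(tendsto_inv₀ hz).mono_left nhdsWithin_le_nhds, ?_⟩
  filter_upwards [self_mem_nhdsWithin] with w hw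
  have hw' : 1 < ‖w‖ := hw
  simpa using inv_lt_one_of_one_lt₀ hw'

lemma exists_comesFromInside (hr : 1 ≤ r) (har : a (-(r : ℤ)) ≠ 0) (hC : CauchyStable r p a)
    {z : ℂ} (hz : ‖z‖ = 1) :
    ∃ t ≤ (charPoly r p a z).roots, t.card = r ∧ ComesFromInside r p a z t ∧
      ∀ i, Tendsto (fun w => (rootPoly (insideRoots r p a w)).coeff i)
        (𝓝[{w : ℂ | 1 < ‖w‖}] z) (𝓝 ((rootPoly t).coeff i)) := by
  have hz0 : z ≠ 0 := ne_zero_of_one_le_norm hz.ge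
  have hA := norm_symbolPoly_eval_le hC
  obtain ⟨t, hle, hcard, ht⟩ := exists_boundary_limit hr hA (u₀ := z⁻¹) (by simp [hz])
    (zero_notMem_pencil_roots hr (by rwa [symbolPoly_eval_zero]) (inv_ne_zero hz0)).1
  have heq : ∀ᶠ w in 𝓝[{w : ℂ | 1 < ‖w‖}] z,
      insideRoots r p a w = diskRoots (pencil (symbolPoly r p a) r w⁻¹) := by
    filter_upwards [self_mem_nhdsWithin] with w hw
    exact insideRoots_eq (ne_zero_of_one_le_norm (le_of_lt hw))
  refine ⟨t, by rwa [charPoly_roots_eq hz0], hcard, fun ε hε => ?_, fun i => ?_⟩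
  · have := (tendsto_inv_nhdsWithin hz0).eventually
      (eventually_rel_of_tendsto_coeff (eventually_diskRoots hA z⁻¹) ht hε)
    filter_upwards [this, heq] with w hw hw'
    rwa [hw']
  · refine ((ht i).comp (tendsto_inv_nhdsWithin hz0)).congr' ?_
    filter_upwards [heq] with w hw
    rw [hw, Function.comp_apply]

lemma stableRoots_eq_insideRoots {z : ℂ} (hz : 1 < ‖z‖) :
    stableRoots r p a z = insideRoots r p a z := if_pos hz

/-- Existence rules out the default value in `stableRoots`, and uniqueness makes the choice there
immaterial. -/
lemma comesFromInside_iff (hr : 1 ≤ r) (har : a (-(r : ℤ)) ≠ 0) (hC : CauchyStable r p a)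
    {z : ℂ} (hz : ‖z‖ = 1) (s : Multiset ℂ) :
    ComesFromInside r p a z s ↔ s = stableRoots r p a z := by
  have := neBot_nhdsWithin_one_lt_norm hz.ge
  obtain ⟨t, -, -, ht, -⟩ := exists_comesFromInside hr har hC hz
  have hex : ∃ s, ComesFromInside r p a z s := ⟨t, ht⟩
  have hst : stableRoots r p a z = hex.choose := by
    rw [stableRoots, if_neg (by rw [hz]; exact lt_irrefl 1), dif_pos hex]
  constructor
  · intro hs
    rw [hst]
    exact hs.unique hex.choose_spec
  · rintro rfl
    rw [hst]
    exact hex.choose_spec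

lemma stableRoots_spec (hr : 1 ≤ r) (har : a (-(r : ℤ)) ≠ 0) (hC : CauchyStable r p a)
    {z : ℂ} (hz : ‖z‖ = 1) :
    stableRoots r p a z ≤ (charPoly r p a z).roots ∧ (stableRoots r p a z).card = r ∧
      ∀ i, Tendsto (fun w => (rootPoly (insideRoots r p a w)).coeff i)
        (𝓝[{w : ℂ | 1 < ‖w‖}] z) (𝓝 ((rootPoly (stableRoots r p a z)).coeff i)) := by
  obtain ⟨t, hle, hcard, ht, htend⟩ := exists_comesFromInside hr har hC hz
  rw [← (comesFromInside_iff hr har hC hz t).1 ht]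
  exact ⟨hle, hcard, htend⟩

lemma card_stableRoots (hr : 1 ≤ r) (har : a (-(r : ℤ)) ≠ 0) (hC : CauchyStable r p a)
    {z : ℂ} (hz : 1 ≤ ‖z‖) : (stableRoots r p a z).card = r := by
  rcases hz.eq_or_lt with h | h
  · exact (stableRoots_spec hr har hC h.symm).2.1
  · rw [stableRoots_eq_insideRoots h, insideRoots_eq (ne_zero_of_one_le_norm hz)]
    exact card_diskRoots (norm_symbolPoly_eval_le hC) (by
      rw [norm_inv]
      exact inv_lt_one_of_one_lt₀ h)

lemma zero_notMem_stableRoots (hr : 1 ≤ r) (har : a (-(r : ℤ)) ≠ 0) (hC : CauchyStable r p a)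
    {z : ℂ} (hz : 1 ≤ ‖z‖) : (0 : ℂ) ∉ stableRoots r p a z := by
  have hle : stableRoots r p a z ≤ (charPoly r p a z).roots := by
    rcases hz.eq_or_lt with h | h
    · exact (stableRoots_spec hr har hC h.symm).1
    · rw [stableRoots_eq_insideRoots h]
      exact Multiset.filter_le _ _
  have hz0 := ne_zero_of_one_le_norm hz
  rw [charPoly_roots_eq hz0] at hle
  exact fun h => (zero_notMem_pencil_roots hr (by rwa [symbolPoly_eval_zero])
    (inv_ne_zero hz0)).2 (Multiset.mem_of_le hle h)

/-! ### Regularity of the stable root polynomial and of `Δ` -/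

lemma differentiableOn_stable_coeff (hC : CauchyStable r p a) (i : ℕ) :
    DifferentiableOn ℂ (fun z => (rootPoly (stableRoots r p a z)).coeff i) {z : ℂ | 1 < ‖z‖} := by
  have hinv : DifferentiableOn ℂ (fun z : ℂ => z⁻¹) {z : ℂ | 1 < ‖z‖} := fun z hz =>
    (differentiableAt_inv (ne_zero_of_one_le_norm (le_of_lt hz))).differentiableWithinAt
  refine ((differentiableOn_rootPoly_diskRoots_coeff (r := r)
    (norm_symbolPoly_eval_le hC) i).comp hinv fun z hz => ?_).congr fun z hz => ?_
  · have hz' : 1 < ‖z‖ := hz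
    simpa using inv_lt_one_of_one_lt₀ hz'
  · rw [stableRoots_eq_insideRoots hz, insideRoots_eq (ne_zero_of_one_le_norm (le_of_lt hz)),
      Function.comp_apply]

/-- The values on `|z| = 1` are limits from the dense part `|z| > 1`. A function extended by limits
is continuous, so boundary points need not be compared with one another directly. -/
lemma continuousOn_stable_coeff (hr : 1 ≤ r) (har : a (-(r : ℤ)) ≠ 0) (hC : CauchyStable r p a)
    (i : ℕ) :
    ContinuousOn (fun z => (rootPoly (stableRoots r p a z)).coeff i) {z : ℂ | 1 ≤ ‖z‖} := by
  have htend : ∀ z : ℂ, 1 ≤ ‖z‖ → Tendsto (fun w => (rootPoly (stableRoots r p a w)).coeff i)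
      (𝓝[{w : ℂ | 1 < ‖w‖}] z) (𝓝 ((rootPoly (stableRoots r p a z)).coeff i)) := by
    intro z hz
    rcases hz.eq_or_lt with h | h
    · refine ((stableRoots_spec hr har hC h.symm).2.2 i).congr' ?_
      filter_upwards [self_mem_nhdsWithin] with w hw
      rw [stableRoots_eq_insideRoots hw]
    · exact (differentiableOn_stable_coeff hC i).continuousOn z h
  have hcl : {z : ℂ | 1 ≤ ‖z‖} ⊆ closure {z : ℂ | 1 < ‖z‖} := fun z hz =>
    mem_closure_iff_nhdsWithin_neBot.2 (neBot_nhdsWithin_one_lt_norm hz)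
  exact (continuousOn_extendFrom hcl fun z hz => ⟨_, htend z hz⟩).congr fun z hz =>
    (extendFrom_eq (hcl hz) (htend z hz)).symm

lemma rootPoly_stableRoots_spec (hr : 1 ≤ r) (har : a (-(r : ℤ)) ≠ 0) (hC : CauchyStable r p a)
    {z : ℂ} (hz : 1 ≤ ‖z‖) : (rootPoly (stableRoots r p a z)).Monic ∧
      (rootPoly (stableRoots r p a z)).natDegree = r :=
  ⟨rootPoly_monic _, by rw [rootPoly_natDegree, card_stableRoots hr har hC hz]⟩

lemma differentiableOn_intrinsicDet (hr : 1 ≤ r) (har : a (-(r : ℤ)) ≠ 0)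
    (hC : CauchyStable r p a) (b : Matrix (Fin r) (Fin m) ℂ) :
    DifferentiableOn ℂ (intrinsicDet r p m a b) {z : ℂ | 1 < ‖z‖} := by
  refine DifferentiableOn.congr ?_ fun z hz => intrinsicDet_eq b
    (zero_notMem_stableRoots hr har hC (le_of_lt hz)) (card_stableRoots hr har hC (le_of_lt hz))
  simp only [Matrix.det_apply']
  refine DifferentiableOn.fun_sum fun σ _ => DifferentiableOn.const_mul
    (DifferentiableOn.fun_finsetProd fun i _ => ?_) _
  simp only [Matrix.sub_apply, Matrix.smul_apply, Matrix.mul_apply, smul_eq_mul, remMatrix,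
    Matrix.of_apply]
  refine (differentiableOn_id.mul_const _).sub (DifferentiableOn.fun_sum fun k _ => ?_)
  exact (differentiableOn_X_pow_modByMonic_coeff hr (fun z hz =>
    rootPoly_stableRoots_spec hr har hC (le_of_lt hz)) (differentiableOn_stable_coeff hC)
    _ _).const_mul _

lemma continuousOn_intrinsicDet (hr : 1 ≤ r) (har : a (-(r : ℤ)) ≠ 0)
    (hC : CauchyStable r p a) (b : Matrix (Fin r) (Fin m) ℂ) :
    ContinuousOn (intrinsicDet r p m a b) {z : ℂ | 1 ≤ ‖z‖} := by
  refine ContinuousOn.congr ?_ fun z hz => intrinsicDet_eq b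
    (zero_notMem_stableRoots hr har hC hz) (card_stableRoots hr har hC hz)
  simp only [Matrix.det_apply']
  refine continuousOn_finsetSum _ fun σ _ => continuousOn_const.mul
    (continuousOn_finsetProd _ fun i _ => ?_)
  simp only [Matrix.sub_apply, Matrix.smul_apply, Matrix.mul_apply, smul_eq_mul, remMatrix,
    Matrix.of_apply]
  refine (continuousOn_id.mul continuousOn_const).sub (continuousOn_finsetSum _ fun k _ => ?_)
  refine continuousOn_const.mul fun z hz => ?_
  have hspec := rootPoly_stableRoots_spec hr har hC hz
  exact tendsto_X_pow_modByMonic_coeff hr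
    (eventually_mem_nhdsWithin.mono fun w hw => rootPoly_stableRoots_spec hr har hC hw)
    hspec.1 hspec.2 (fun i => continuousOn_stable_coeff hr har hC i z hz) _ _

end stable

end

end KreissLopatinskii

/-- The first three conjuncts say that `Δ` is well defined on `{|z| ≥ 1}`; the last two are its
holomorphy on `{|z| > 1}` and its continuity on `{|z| ≥ 1}`. -/
theorem theorem3p1 (r p m : ℕ) (hr : 1 ≤ r) (hp : 1 ≤ p) (hm : p + r ≤ m)
    (a : ℤ → ℂ) (hap : a (p : ℤ) ≠ 0) (har : a (-(r : ℤ)) ≠ 0)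
    (b : Matrix (Fin r) (Fin m) ℂ) (hC : KreissLopatinskii.CauchyStable r p a) :
    (∀ z : ℂ, ‖z‖ = 1 → ∀ s : Multiset ℂ,
      KreissLopatinskii.ComesFromInside r p a z s ↔ s = KreissLopatinskii.stableRoots r p a z) ∧
    (∀ z : ℂ, 1 ≤ ‖z‖ → Multiset.card (KreissLopatinskii.stableRoots r p a z) = r) ∧
    (∀ z : ℂ, 1 ≤ ‖z‖ → ∀ e : Fin r ≃ (KreissLopatinskii.stableRoots r p a z).ToType,
      (KreissLopatinskii.kMat r p a z e r).det ≠ 0 ∧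
      KreissLopatinskii.intrinsicDet r p m a b z =
        KreissLopatinskii.klDet r p m a b z e / (KreissLopatinskii.kMat r p a z e r).det) ∧
    DifferentiableOn ℂ (KreissLopatinskii.intrinsicDet r p m a b) {z : ℂ | 1 < ‖z‖} ∧
    ContinuousOn (KreissLopatinskii.intrinsicDet r p m a b) {z : ℂ | 1 ≤ ‖z‖} := by
  refine ⟨fun z hz s => KreissLopatinskii.comesFromInside_iff hr har hC hz s,
    fun z hz => KreissLopatinskii.card_stableRoots hr har hC hz, fun z hz e => ?_,
    KreissLopatinskii.differentiableOn_intrinsicDet hr har hC b, KreissLopatinskii.continuousOn_intrinsicDet hr har hC b⟩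
  have hs := KreissLopatinskii.zero_notMem_stableRoots hr har hC hz
  refine ⟨KreissLopatinskii.kMatrix_det_ne_zero hs e, ?_⟩
  rw [KreissLopatinskii.intrinsicDet_eq b hs (KreissLopatinskii.card_stableRoots hr har hC hz),
    KreissLopatinskii.klDet_div_eq b hs e]
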